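/- All Banach spaces are real. A \emph{rational Banach space} is $\mathbb R^n$ ($n\ge 0$) with a norm whose closed unit ball is the convex hull of finitely many vectors with rational coordinates. A \emph{rational arrow} $E\to F$ between rational Banach spaces $E=\mathbb R^n$ and $F=\mathbb R^m$ is a pair $(e,P)$ of linear operators $e:E\to F$, $P:F\to E$ such that $e$ is an isometric embedding, $\|P\|\le 1$, $P\circ e=\mathrm{id}_E$, $e[\mathbb Q^n]\subseteq\mathbb Q^m$ and $P[\mathbb Q^m]\subseteq\mathbb Q^n$; arrows are composed by $(e',P')\circ(e,P)=(e'\circ e,\,P\circ P')$. A sequence $U_0\to U_1\to U_2\to\cdots$ in the resulting category (a functor from $\mathbb N$) is a \emph{Fra\"iss\'e sequence} if for every $n$ and every rational arrow $f:U_n\to Y$ there are $m>n$ and a rational arrow $g:Y\to U_m$ such that $g\circ f$ is the bonding arrow $U_n\to U_m$. Given a Fra\"iss\'e sequence $(U_n)_{n\in\mathbb N}$, let $\mathbf P$ be the completion of the union of the chain $U_0\subseteq U_1\subseteq U_2\subseteq\cdots$ (the direct limit of the spaces $U_n$ along the bonding embeddings). A subspace $Y$ of a Banach space $X$ is \emph{$1$-complemented}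 in $X$ if there is a linear projection of norm at most $1$ from $X$ onto $Y$; it is \emph{$(1,\varepsilon)$-complemented} in $X$ if there is a linear operator $T:X\to Y$ with $\|T\|\le 1$ and $\|Ty-y\|\le\varepsilon\|y\|$ for all $y\in Y$. A linear operator $g:F\to X$ is an \emph{$\varepsilon$-isometric embedding} if $(1-\varepsilon)\|x\|\le\|g(x)\|\le\|x\|$ for all $x\in F$. \textbf{Theorem.} Let $\mathbf P$ be the space obtained as above from any Fra\"iss\'e sequence. Then $\mathbf P$ satisfies the almost-extension property (E): whenever $E\subseteq F$ are finite-dimensional Banach spaces such that $E$ is $1$-complemented in $F$, and $i:E\to\mathbf P$ is a linear isometric embedding such that $i[E]$ is $1$-complemented in $\mathbf P$, then for every $\varepsilon>0$ there is an $\varepsilon$-isometric embedding $g:F\to\mathbf P$ such that $\|g|_E-i\|<\varepsilon$ and $g[F]$ is $(1,\varepsilon)$-complemented in $\mathbf P$. -/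

import Mathlib

open CategoryTheory

universe u v

noncomputable section

/-! ## Embedding-projection pairs and rational spaces -/

/-- An embedding-projection pair `(e, P) : E → F`: a linear isometric embedding `e : E → F` and an
operator `P : F → E` of norm at most `1` with `P ∘ e = id`. -/
@[ext]
structure EPPair (E F : Type*) [NormedAddCommGroup E] [NormedSpace ℝ E]
    [NormedAddCommGroup F] [NormedSpace ℝ F] where
  emb : E →ₗᵢ[ℝ] F
  proj : F →L[ℝ] E
  norm_proj_le : ‖proj‖ ≤ 1
  proj_emb : ∀ x, proj (emb x) = x

namespace EPPair

variable {E F G : Type*} [NormedAddCommGroup E] [NormedSpace ℝ E]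
  [NormedAddCommGroup F] [NormedSpace ℝ F] [NormedAddCommGroup G] [NormedSpace ℝ G]

/-- The identity pair. -/
def refl (E : Type*) [NormedAddCommGroup E] [NormedSpace ℝ E] : EPPair E E where
  emb := LinearIsometry.id
  proj := ContinuousLinearMap.id ℝ E
  norm_proj_le := ContinuousLinearMap.norm_id_le
  proj_emb _ := rfl

/-- Composition of pairs: embeddings and projections are composed separately. -/
def trans (a : EPPair E F) (b : EPPair F G) : EPPair E G where
  emb := b.emb.comp a.emb
  proj := a.proj.comp b.proj
  norm_proj_le := (a.proj.opNorm_comp_le b.proj).trans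
    (mul_le_one₀ a.norm_proj_le (norm_nonneg _) b.norm_proj_le)
  proj_emb x := by simp [b.proj_emb, a.proj_emb]

end EPPair

/-- The inclusion of `ℚⁿ` into `ℝⁿ`. -/
def ratVec {n : ℕ} (q : Fin n → ℚ) : Fin n → ℝ := fun i => (q i : ℝ)

/-- A rational Banach space: `ℝⁿ` with a norm whose closed unit ball is the convex hull of finitely
many vectors with rational coordinates. -/
structure RationalSpace where
  dim : ℕ
  norm : Seminorm ℝ (Fin dim → ℝ)
  eq_zero_of_norm_eq_zero : ∀ x, norm x = 0 → x = 0
  unitBall_eq : ∃ s : Finset (Fin dim → ℚ),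
    {x | norm x ≤ 1} = convexHull ℝ (ratVec '' (s : Set (Fin dim → ℚ)))

namespace RationalSpace

/-- The underlying vector space `ℝⁿ` of a rational space. It is a type synonym, since it carries the
norm of the rational space instead of the default norm of `Fin n → ℝ`. -/
def Carrier (V : RationalSpace) : Type := Fin V.dim → ℝ

instance : CoeSort RationalSpace Type := ⟨Carrier⟩

instance (V : RationalSpace) : AddCommGroup V := inferInstanceAs (AddCommGroup (Fin V.dim → ℝ))

instance (V : RationalSpace) : Module ℝ V := inferInstanceAs (Module ℝ (Fin V.dim → ℝ))

instance (V : RationalSpace) : Norm V := ⟨V.norm⟩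

theorem core (V : RationalSpace) : NormedSpace.Core ℝ V where
  norm_nonneg x := apply_nonneg V.norm x
  norm_smul c x := map_smul_eq_mul V.norm c x
  norm_triangle x y := map_add_le_add V.norm x y
  norm_eq_zero_iff x := ⟨V.eq_zero_of_norm_eq_zero x, fun h => by
    subst h; exact map_zero V.norm⟩

instance (V : RationalSpace) : NormedAddCommGroup V := NormedAddCommGroup.ofCore V.core

instance (V : RationalSpace) : NormedSpace ℝ V := NormedSpace.ofCore V.core

/-- The point of `V` with the given rational coordinates. -/
def ratPoint (V : RationalSpace) (q : Fin V.dim → ℚ) : V := ratVec q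

/-- An operator between rational spaces is rational if it maps `ℚⁿ` into `ℚᵐ`. -/
def IsRationalMap {V W : RationalSpace} (T : V → W) : Prop :=
  ∀ q : Fin V.dim → ℚ, ∃ r : Fin W.dim → ℚ, T (V.ratPoint q) = W.ratPoint r

/-- A rational arrow: an embedding-projection pair between rational spaces, both components of which
are rational operators. -/
@[ext]
structure Hom (V W : RationalSpace) extends EPPair V W where
  rational_emb : IsRationalMap emb
  rational_proj : IsRationalMap proj

/-- The category of rational spaces and rational embedding-projection pairs. -/
instance : Category RationalSpace where
  Hom := Hom
  id V := ⟨EPPair.refl V, fun q => ⟨q, rfl⟩, fun q => ⟨q, rfl⟩⟩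
  comp a b := ⟨a.toEPPair.trans b.toEPPair,
    fun q => by
      obtain ⟨r, hr⟩ := a.rational_emb q
      obtain ⟨s, hs⟩ := b.rational_emb r
      exact ⟨s, (congrArg b.emb hr).trans hs⟩,
    fun q => by
      obtain ⟨r, hr⟩ := b.rational_proj q
      obtain ⟨s, hs⟩ := a.rational_proj r
      exact ⟨s, (congrArg a.proj hr).trans hs⟩⟩

end RationalSpace

/-! ## Fraïssé sequences and their limits -/

/-- A sequence of rational arrows is a functor from `ℕ`. -/
abbrev RationalSeq := ℕ ⥤ RationalSpace

namespace RationalSeq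

/-- The sequence `U` is Fraïssé: for every `n` and every rational arrow `f : U n ⟶ Y` there are
`m > n` and a rational arrow `g : Y ⟶ U m` such that `g ∘ f` is the bonding arrow
`U n ⟶ U m`. -/
def IsFraisse (U : RationalSeq) : Prop :=
  ∀ (n : ℕ) (Y : RationalSpace) (f : U.obj n ⟶ Y),
    ∃ (m : ℕ) (h : n < m) (g : Y ⟶ U.obj m), f ≫ g = U.map (homOfLE h.le)

/-- The bonding embedding `U i → U j` for `i ≤ j`. -/
def bondEmb (U : RationalSeq) (i j : ℕ) (h : i ≤ j) : U.obj i →ₗᵢ[ℝ] U.obj j :=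
  (U.map (homOfLE h)).emb

instance (U : RationalSeq) :
    DirectedSystem (fun n => (U.obj n : Type)) (fun i j h => U.bondEmb i j h) where
  map_self i x := by
    have h : U.map (homOfLE (le_refl i)) = 𝟙 (U.obj i) := U.map_id i
    change (U.map (homOfLE (le_refl i))).emb x = x
    rw [h]; rfl
  map_map k j i hij hjk x := by
    have h : U.map (homOfLE (hij.trans hjk)) = U.map (homOfLE hij) ≫ U.map (homOfLE hjk) :=
      U.map_comp (homOfLE hij) (homOfLE hjk)
    change (U.map (homOfLE hjk)).emb ((U.map (homOfLE hij)).emb x) =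
      (U.map (homOfLE (hij.trans hjk))).emb x
    rw [h]; rfl

/-- The union of the chain `U 0 ⊆ U 1 ⊆ ⋯`, that is, the direct limit of the spaces `U n` along the
bonding embeddings. -/
def Union (U : RationalSeq) : Type :=
  DirectLimit (fun n => (U.obj n : Type)) U.bondEmb

instance (U : RationalSeq) : AddCommGroup U.Union :=
  inferInstanceAs (AddCommGroup (DirectLimit (fun n => (U.obj n : Type)) U.bondEmb))

instance (U : RationalSeq) : Module ℝ U.Union :=
  inferInstanceAs (Module ℝ (DirectLimit (fun n => (U.obj n : Type)) U.bondEmb))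

/-- The norm on the union that extends the norm of each `U n`. -/
instance (U : RationalSeq) : Norm U.Union where
  norm := DirectLimit.lift U.bondEmb (fun _ x => ‖x‖)
    fun i j h x => ((U.bondEmb i j h).norm_map x).symm

theorem Union.core (U : RationalSeq) : NormedSpace.Core ℝ U.Union where
  norm_nonneg x := by
    obtain ⟨i, x, rfl⟩ := DirectLimit.exists_eq_mk U.bondEmb x
    exact norm_nonneg x
  norm_smul c x := by
    obtain ⟨i, x, rfl⟩ := DirectLimit.exists_eq_mk U.bondEmb x
    exact norm_smul c x
  norm_triangle x y := by
    obtain ⟨i, x, y, rfl, rfl⟩ := DirectLimit.exists_eq_mk₂ U.bondEmb x y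
    have h := DirectLimit.add_def (f := U.bondEmb) i x y
    exact (congrArg (fun z : U.Union => ‖z‖) h).trans_le (norm_add_le x y)
  norm_eq_zero_iff x := by
    obtain ⟨i, x, rfl⟩ := DirectLimit.exists_eq_mk U.bondEmb x
    have h : (0 : DirectLimit (fun n => (U.obj n : Type)) U.bondEmb) = ⟦⟨i, 0⟩⟧ :=
      DirectLimit.zero_def i
    change ‖x‖ = 0 ↔
      (⟦⟨i, x⟩⟧ : DirectLimit (fun n => (U.obj n : Type)) U.bondEmb) = 0
    rw [h, norm_eq_zero]
    exact ⟨fun hx => by rw [hx], fun hx =>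
      DirectLimit.mk_injective U.bondEmb (fun i j h => (U.bondEmb i j h).injective) i hx⟩

instance (U : RationalSeq) : NormedAddCommGroup U.Union := NormedAddCommGroup.ofCore (Union.core U)

instance (U : RationalSeq) : NormedSpace ℝ U.Union := NormedSpace.ofCore (Union.core U)

/-- The Banach space given by a sequence: the completion of the union of the spaces `U n`. For a
Fraïssé sequence `U` this is the space `𝐏`. -/
abbrev Limit (U : RationalSeq) : Type := UniformSpace.Completion U.Union

end RationalSeq

/-! ## The almost-extension property -/

section Extension

variable {X : Type*} [NormedAddCommGroup X] [NormedSpace ℝ X]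

/-- `Y` is `1`-complemented in `X`: there is a projection of norm at most `1` from `X` onto `Y`. -/
def IsOneComplemented (Y : Submodule ℝ X) : Prop :=
  ∃ P : X →L[ℝ] Y, ‖P‖ ≤ 1 ∧ ∀ y : Y, P y = y

/-- `Y` is `(1, ε)`-complemented in `X`: there is an operator `T : X → Y` of norm at most `1` such
that `‖T y - y‖ ≤ ε ‖y‖` for all `y ∈ Y`. -/
def IsOneComplementedUpTo (ε : ℝ) (Y : Submodule ℝ X) : Prop :=
  ∃ T : X →L[ℝ] Y, ‖T‖ ≤ 1 ∧ ∀ y : Y, ‖T y - y‖ ≤ ε * ‖y‖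

/-- `f` is an `ε`-isometric embedding: `(1 - ε) ‖x‖ ≤ ‖f x‖ ≤ ‖x‖` for all `x`. -/
def IsEpsIsometry {F : Type*} [NormedAddCommGroup F] [NormedSpace ℝ F] (ε : ℝ)
    (f : F →L[ℝ] X) : Prop :=
  ∀ x, (1 - ε) * ‖x‖ ≤ ‖f x‖ ∧ ‖f x‖ ≤ ‖x‖

end Extension

/-- The almost-extension property (E) of a Banach space `X`, where the finite-dimensional spaces
`E ⊆ F` range over an arbitrary universe. -/
def ConditionE (X : Type v) [NormedAddCommGroup X] [NormedSpace ℝ X] : Prop :=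
  ∀ (F : Type u) [NormedAddCommGroup F] [NormedSpace ℝ F] [FiniteDimensional ℝ F]
    (E : Submodule ℝ F), IsOneComplemented E →
    ∀ i : E →ₗᵢ[ℝ] X, IsOneComplemented (LinearMap.range i.toLinearMap) →
    ∀ ε : ℝ, 0 < ε →
      ∃ g : F →L[ℝ] X, IsEpsIsometry ε g ∧
        ‖g.comp E.subtypeL - i.toContinuousLinearMap‖ < ε ∧
        IsOneComplementedUpTo ε (LinearMap.range g.toLinearMap)

end

/-!
Let `r : 𝐏 → E` be the left inverse of `i` given by the projection onto `i[E]`, and let `S : F → E`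
be a projection of norm at most `1`. Every `U n` is `1`-complemented in `𝐏`, with inclusion `η` and
projection `π` (`RationalSeq.limitPair`), and the operators `η ∘ π` converge to the identity
pointwise, hence uniformly on the unit ball of `i[E]`. For large `n`, the contraction
`i₀ = π ∘ i : E → U n` therefore has the contraction `r ∘ η` as a left inverse up to a small `δ`.

So it suffices to amalgamate `E → U n` and `E ⊆ F` approximately in a rational space. The product
`U n × F` with the maximum norm does it: `v ↦ (v, r (η v))` and `x ↦ (i₀ (S x), x)` are isometric
embeddings of `U n` and `F`, the coordinate projections are left inverses of norm at most `1`, and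
on `E` the two embeddings agree up to `δ`. Only the embedding of `U n` and its projection have to
be rational. In the coordinates of `ℝⁿ⁺ᵈ` in which the graph `{(v, r (η v))}` is `ℝⁿ × 0` and the
first projection is the coordinate projection, they are. What remains is to replace the norm by a
slightly larger one with a rational polytope as its unit ball, which is
`exists_rational_seminorm`; the vertices of the unit ball of `U n` are kept among the spanning
vectors, so that `U n` stays isometrically embedded.

The Fraïssé property absorbs the resulting space `Y` into some `U m` over `U n`. The composition
`F → Y → U m → 𝐏` is `g`, and `𝐏 → U m → Y → F → g[F]` is the almost projection: on `g[F]` it is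
multiplication by `(1 + δ)⁻¹`.
-/

/-! ### Approximation of norms by rational polytopes -/

open Set Topology in
/-- Every neighbourhood of `x` contains a box around `x` with rational corners. -/
theorem exists_finset_convexHull_ratVec_mem_nhds {m : ℕ} {x : Fin m → ℝ} {O : Set (Fin m → ℝ)}
    (hO : O ∈ 𝓝 x) : ∃ t : Finset (Fin m → ℚ),
      convexHull ℝ (ratVec '' (t : Set (Fin m → ℚ))) ∈ 𝓝 x ∧
      convexHull ℝ (ratVec '' (t : Set (Fin m → ℚ))) ⊆ O := by
  classical
  obtain ⟨ρ, hρ, hball⟩ := Metric.mem_nhds_iff.1 hO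
  choose a ha ha' using fun i => exists_rat_btwn (show x i - ρ / 2 < x i by linarith)
  choose b hb hb' using fun i => exists_rat_btwn (show x i < x i + ρ / 2 by linarith)
  have himg : ratVec '' (Fintype.piFinset fun i => ({a i, b i} : Finset ℚ) : Set (Fin m → ℚ)) =
      univ.pi fun i => ({(a i : ℝ), (b i : ℝ)} : Set ℝ) := by
    ext y
    constructor
    · rintro ⟨q, hq, rfl⟩ i -
      have := Fintype.mem_piFinset.1 (Finset.mem_coe.1 hq) i
      simp only [Finset.mem_insert, Finset.mem_singleton] at this
      simpa [ratVec] using this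
    · intro hy
      refine ⟨fun i => if y i = a i then a i else b i, ?_, ?_⟩
      · refine Finset.mem_coe.2 (Fintype.mem_piFinset.2 fun i => ?_)
        split_ifs <;> simp
      · funext i
        have := hy i (mem_univ i)
        simp only [mem_insert_iff, mem_singleton_iff] at this
        by_cases h : y i = a i
        · simp [ratVec, h]
        · simpa [ratVec, h] using (this.resolve_left h).symm
  have hhull : convexHull ℝ
      (ratVec '' (Fintype.piFinset fun i => ({a i, b i} : Finset ℚ) : Set (Fin m → ℚ))) =
      univ.pi fun i => Icc (a i : ℝ) (b i : ℝ) := by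
    rw [himg, convexHull_pi]
    refine pi_congr rfl fun i _ => ?_
    rw [convexHull_pair, segment_eq_Icc ((ha' i).trans (hb i)).le]
  refine ⟨Fintype.piFinset fun i => {a i, b i}, ?_, ?_⟩
  · rw [hhull]
    exact set_pi_mem_nhds finite_univ fun i _ => Icc_mem_nhds (ha' i) (hb i)
  · rw [hhull]
    refine fun y hy => hball ?_
    refine (dist_pi_lt_iff hρ).2 fun i => ?_
    have := hy i (mem_univ i)
    rw [Real.dist_eq, abs_lt]
    constructor <;> linarith [ha i, hb' i, this.1, this.2]

open Set Topology in
/-- Every norm on `ℝᵐ`, given as `x ↦ ‖Φ x‖`, is `(1 + δ)`-equivalent to a larger one whose unit ball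
is the convex hull of finitely many rational vectors, and any finite set `B` of rational vectors of
the original unit ball can be kept in the new one. The new unit ball is spanned by `B` and by the
corners of finitely many rational boxes inside the original ball that cover the ball of radius
`(1 + δ)⁻¹`; the new norm is its gauge. -/
theorem exists_rational_seminorm {m : ℕ} {W : Type*} [NormedAddCommGroup W] [NormedSpace ℝ W]
    [FiniteDimensional ℝ W] (Φ : (Fin m → ℝ) ≃ₗ[ℝ] W) (B : Finset (Fin m → ℚ))
    (hB : ∀ q ∈ B, ‖Φ (ratVec q)‖ ≤ 1) {δ : ℝ} (hδ : 0 < δ) :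
    ∃ M : Seminorm ℝ (Fin m → ℝ), (∀ x, ‖Φ x‖ ≤ M x) ∧ (∀ x, M x ≤ (1 + δ) * ‖Φ x‖) ∧
      (∀ q ∈ B, M (ratVec q) ≤ 1) ∧
      ∃ s : Finset (Fin m → ℚ), {x | M x ≤ 1} = convexHull ℝ (ratVec '' (s : Set (Fin m → ℚ))) := by
  classical
  have hcont : Continuous Φ := Φ.toLinearMap.continuous_of_finiteDimensional
  set K : Set (Fin m → ℝ) := {x | ‖Φ x‖ ≤ (1 + δ)⁻¹} with hK
  have hKc : IsCompact K := by
    have : K = Φ.toContinuousLinearEquiv.toHomeomorph ⁻¹' (Metric.closedBall 0 (1 + δ)⁻¹) := by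
      ext x; simp [hK]
    rw [this, Homeomorph.isCompact_preimage]
    have := FiniteDimensional.proper_real W
    exact isCompact_closedBall _ _
  have hlt : (1 + δ)⁻¹ < 1 := inv_lt_one_of_one_lt₀ (by linarith)
  have hO : ∀ x ∈ K, {x | ‖Φ x‖ < 1} ∈ 𝓝 x := fun x hx =>
    (isOpen_lt hcont.norm continuous_const).mem_nhds (lt_of_le_of_lt hx hlt)
  choose! t ht ht' using fun x hx => exists_finset_convexHull_ratVec_mem_nhds (hO x hx)
  obtain ⟨I, hIK, hI⟩ := hKc.elim_nhds_subcover _ ht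
  set A : Finset (Fin m → ℚ) := B ∪ I.biUnion t with hA
  have hA1 : ∀ q ∈ A, ‖Φ (ratVec q)‖ ≤ 1 := by
    intro q hq
    rcases Finset.mem_union.1 hq with h | h
    · exact hB q h
    · obtain ⟨x, hx, hqx⟩ := Finset.mem_biUnion.1 h
      exact (ht' x (hIK x hx) (subset_convexHull ℝ _ (mem_image_of_mem _ hqx))).le
  have hneg : ∀ q : Fin m → ℚ, ratVec (-q) = -ratVec q := fun q => by
    funext i; simp [ratVec]
  -- Symmetrized, so that the gauge of the hull is a seminorm.
  set s : Finset (Fin m → ℚ) := A ∪ A.image (fun q => -q) with hs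
  set C : Set (Fin m → ℝ) := convexHull ℝ (ratVec '' (s : Set (Fin m → ℚ))) with hC
  have hCconv : Convex ℝ C := convex_convexHull ℝ _
  have hCle : C ⊆ {x | ‖Φ x‖ ≤ 1} := by
    refine convexHull_min ?_ ?_
    · rintro _ ⟨q, hq, rfl⟩
      rcases Finset.mem_union.1 (Finset.mem_coe.1 hq) with h | h
      · exact hA1 q h
      · obtain ⟨p, hp, rfl⟩ := Finset.mem_image.1 h
        simpa [hneg] using hA1 p hp
    · have : {x | ‖Φ x‖ ≤ 1} = Φ.toLinearMap ⁻¹' Metric.closedBall 0 1 := by ext x; simp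
      rw [this]
      exact (convex_closedBall _ _).linear_preimage _
  have hKC : K ⊆ C := by
    refine hI.trans (iUnion₂_subset fun x hx => convexHull_mono (image_mono ?_))
    intro q hq
    exact Finset.mem_coe.2 (Finset.mem_union_left _ (Finset.mem_union_right _
      (Finset.mem_biUnion.2 ⟨x, hx, hq⟩)))
  have hC0 : C ∈ 𝓝 (0 : Fin m → ℝ) := by
    refine Filter.mem_of_superset ?_ hKC
    refine Filter.mem_of_superset ((isOpen_lt hcont.norm continuous_const).mem_nhds
      (show ‖Φ 0‖ < (1 + δ)⁻¹ by simp; positivity)) fun x hx => ?_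
    exact (show ‖Φ x‖ < (1 + δ)⁻¹ from hx).le
  have hCneg : -C = C := by
    rw [hC, ← convexHull_neg]
    congr 1
    ext y
    rw [Set.mem_neg]
    have key : ∀ y, y ∈ ratVec '' (s : Set (Fin m → ℚ)) → -y ∈ ratVec '' (s : Set (Fin m → ℚ)) := by
      rintro _ ⟨q, hq, rfl⟩
      refine ⟨-q, ?_, hneg q⟩
      rcases Finset.mem_union.1 (Finset.mem_coe.1 hq) with h | h
      · exact Finset.mem_coe.2 (Finset.mem_union_right _ (Finset.mem_image_of_mem _ h))
      · obtain ⟨p, hp, rfl⟩ := Finset.mem_image.1 h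
        simpa [hs] using Or.inl hp
    exact ⟨fun h => by simpa using key _ h, key y⟩
  have hCbal : Balanced ℝ C := (balanced_iff_neg_mem hCconv).2 fun x hx => by
    rw [← hCneg] at hx; simpa using hx
  have hball : {x | gauge C x ≤ 1} = C := by
    ext x
    rw [mem_ofPred_eq, gauge_le_one_iff_mem_closure hCconv hC0,
      ((s.finite_toSet.image ratVec).isClosed_convexHull ℝ).closure_eq]
  have hsmul : ∀ (c : ℝ), 0 ≤ c → ∀ x, gauge C (c • x) = c * gauge C x := fun c hc x =>
    gauge_smul_of_nonneg hc x
  refine ⟨gaugeSeminorm hCbal hCconv (absorbent_nhds_zero hC0), fun x => ?_, fun x => ?_,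
    fun q hq => ?_, s, hball⟩
  · change ‖Φ x‖ ≤ gauge C x
    refine le_of_forall_gt_imp_ge_of_dense fun c hc => ?_
    have hc0 : 0 < c := (gauge_nonneg x).trans_lt hc
    have : c⁻¹ • x ∈ C := by
      rw [← hball, mem_ofPred_eq, hsmul _ (by positivity), inv_mul_le_iff₀ hc0]; linarith
    have := hCle this
    rw [mem_ofPred_eq, map_smul, norm_smul, Real.norm_of_nonneg (by positivity),
      inv_mul_le_iff₀ hc0] at this
    linarith
  · change gauge C x ≤ (1 + δ) * ‖Φ x‖
    rcases eq_or_ne x 0 with rfl | hx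
    · simp
    have hn : 0 < ‖Φ x‖ := norm_pos_iff.2 (by simpa using hx)
    have : ((1 + δ) * ‖Φ x‖)⁻¹ • x ∈ C := hKC (by
      rw [hK, mem_ofPred_eq, map_smul, norm_smul, Real.norm_of_nonneg (by positivity)]
      field_simp; rfl)
    rw [← hball, mem_ofPred_eq, hsmul _ (by positivity), inv_mul_le_iff₀ (by positivity)] at this
    linarith
  · change gauge C (ratVec q) ≤ 1
    have : ratVec q ∈ C := subset_convexHull ℝ _ (mem_image_of_mem _
      (Finset.mem_coe.2 (Finset.mem_union_left _ (Finset.mem_union_left _ hq))))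
    rwa [← hball] at this

/-! ### Amalgamation of rational spaces -/

theorem one_sub_inv_one_add_le {δ : ℝ} (hδ : 0 ≤ δ) : 1 - (1 + δ)⁻¹ ≤ δ := by
  have h : 1 - (1 + δ)⁻¹ = δ / (1 + δ) := by field_simp; ring
  rw [h]
  exact div_le_self hδ (by linarith)

/-- The splitting of `ℝⁿ⁺ᵈ` into its first `n` and its last `d` coordinates. -/
def finSplit (n d : ℕ) : (Fin (n + d) → ℝ) ≃ₗ[ℝ] (Fin n → ℝ) × (Fin d → ℝ) where
  toFun z := (fun i => z (Fin.castAdd d i), fun j => z (Fin.natAdd n j))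
  map_add' _ _ := rfl
  map_smul' _ _ := rfl
  invFun p := Fin.append p.1 p.2
  left_inv z := Fin.append_castAdd_natAdd
  right_inv p := by simp

namespace RationalSpace

/-- The identification of `ℝⁿ` with the underlying vector space of a rational space. -/
def coords (V : RationalSpace) : (Fin V.dim → ℝ) ≃ₗ[ℝ] V := LinearEquiv.refl ℝ (Fin V.dim → ℝ)

instance (V : RationalSpace) : FiniteDimensional ℝ V :=
  inferInstanceAs (FiniteDimensional ℝ (Fin V.dim → ℝ))

/-- A seminorm on a rational space is dominated by the norm as soon as it is at most `1` at the
vectors that span the unit ball. -/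
theorem norm_le_of_forall_ratPoint (V : RationalSpace) {s : Finset (Fin V.dim → ℚ)}
    (hs : {x | V.norm x ≤ 1} = convexHull ℝ (ratVec '' (s : Set (Fin V.dim → ℚ))))
    (N : Seminorm ℝ V) (hN : ∀ q ∈ s, N (V.ratPoint q) ≤ 1) (v : V) : N v ≤ ‖v‖ := by
  have hsub : {x | V.norm x ≤ 1} ⊆ V.coords ⁻¹' N.closedBall 0 1 := by
    rw [hs]
    refine convexHull_min ?_ ((N.convex_closedBall 0 1).linear_preimage V.coords.toLinearMap)
    rintro _ ⟨q, hq, rfl⟩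
    rw [Set.mem_preimage, N.mem_closedBall_zero]
    exact hN q hq
  rcases eq_or_ne v 0 with rfl | hv
  · simp
  have h0 : 0 < ‖v‖ := norm_pos_iff.2 hv
  have h1 : N (‖v‖⁻¹ • v) ≤ 1 := by
    have : V.norm (V.coords.symm (‖v‖⁻¹ • v)) ≤ 1 := by
      change ‖‖v‖⁻¹ • v‖ ≤ 1
      rw [norm_smul, norm_inv, norm_norm, inv_mul_cancel₀ h0.ne']
    have := hsub this
    rwa [Set.mem_preimage, N.mem_closedBall_zero] at this
  rw [map_smul_eq_mul, norm_inv, norm_norm, inv_mul_le_iff₀ h0, mul_one] at h1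
  exact h1

/-- The graph embedding `v ↦ (v, b v)` of a rational space `V` into the product `V × F`, with the
first projection as its left inverse, becomes a rational arrow after a `(1 + δ)`-renorming of
`V × F` that does not change the norm on the graph. -/
theorem exists_rational_amalgam (V : RationalSpace) {F : Type*} [NormedAddCommGroup F]
    [NormedSpace ℝ F] [FiniteDimensional ℝ F] (b : V →L[ℝ] F) (hb : ‖b‖ ≤ 1) {δ : ℝ} (hδ : 0 < δ) :
    ∃ (Y : RationalSpace) (f : V ⟶ Y) (Φ : Y ≃ₗ[ℝ] V × F), (∀ y, ‖Φ y‖ ≤ ‖y‖) ∧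
      (∀ y, ‖y‖ ≤ (1 + δ) * ‖Φ y‖) ∧ ∀ v, Φ (f.emb v) = (v, b v) := by
  classical
  set n := V.dim
  set d := Module.finrank ℝ F
  -- Coordinates in which the graph of `b` is the coordinate subspace `ℝⁿ` of `ℝⁿ⁺ᵈ` and the first
  -- projection is the coordinate projection: both are then rational, although `b` need not be.
  let Ψ : (Fin (n + d) → ℝ) ≃ₗ[ℝ] V × F := (finSplit n d).trans
    (V.coords.skewProd (Module.finBasis ℝ F).equivFun.symm (b.toLinearMap ∘ₗ V.coords.toLinearMap))
  let ι : V →ₗ[ℝ] (Fin (n + d) → ℝ) :=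
    (finSplit n d).symm.toLinearMap ∘ₗ LinearMap.inl ℝ _ _ ∘ₗ V.coords.symm.toLinearMap
  have hΨι : ∀ v, Ψ (ι v) = (v, b v) := fun v => by simp [Ψ, ι]
  have hnorm : ∀ v, ‖Ψ (ι v)‖ = ‖v‖ := fun v => by
    rw [hΨι, Prod.norm_def, max_eq_left]
    exact (b.le_of_opNorm_le hb v).trans_eq (one_mul _)
  have hιrat : ∀ q : Fin n → ℚ, ι (V.ratPoint q) = ratVec (Fin.append q 0) := fun q => by
    change Fin.append (ratVec q) 0 = ratVec (Fin.append q 0)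
    funext i
    refine Fin.addCases (fun i => ?_) (fun i => ?_) i <;> simp [ratVec]
  obtain ⟨s, hs⟩ := V.unitBall_eq
  have hmem : ∀ q ∈ s, ‖V.ratPoint q‖ ≤ 1 := fun q hq => by
    have : ratVec q ∈ {x | V.norm x ≤ 1} := by
      rw [hs]; exact subset_convexHull ℝ _ (Set.mem_image_of_mem _ hq)
    exact this
  obtain ⟨M, hM1, hM2, hMB, hMs⟩ := exists_rational_seminorm Ψ (s.image fun q => Fin.append q 0)
    (fun p hp => by
      obtain ⟨q, hq, rfl⟩ := Finset.mem_image.1 hp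
      rw [← hιrat, hnorm]
      exact hmem q hq) hδ
  let Y : RationalSpace := ⟨n + d, M, fun x hx => by
    have h := hM1 x
    rw [hx] at h
    simpa using norm_le_zero_iff.1 h, hMs⟩
  let Φ : Y ≃ₗ[ℝ] V × F := Y.coords.symm.trans Ψ
  have hΦ1 : ∀ y : Y, ‖Φ y‖ ≤ ‖y‖ := fun y => hM1 _
  let e : V →ₗ[ℝ] Y := Y.coords.toLinearMap ∘ₗ ι
  have hΦe : ∀ v, Φ (e v) = (v, b v) := hΨι
  have he : ∀ v, ‖e v‖ = ‖v‖ := fun v => by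
    refine le_antisymm ?_ ?_
    · refine V.norm_le_of_forall_ratPoint hs ((normSeminorm ℝ Y).comp e) (fun q hq => ?_) v
      change M (ι (V.ratPoint q)) ≤ 1
      rw [hιrat]
      exact hMB _ (Finset.mem_image_of_mem _ hq)
    · rw [← hnorm v]
      exact hΦ1 (e v)
  let p : Y →L[ℝ] V := LinearMap.mkContinuous (LinearMap.fst ℝ V F ∘ₗ Φ.toLinearMap) 1 fun y => by
    rw [one_mul]
    exact (norm_fst_le (Φ y)).trans (hΦ1 y)
  let f : V ⟶ Y :=
    { emb := ⟨e, he⟩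
      proj := p
      norm_proj_le := LinearMap.mkContinuous_norm_le _ zero_le_one _
      proj_emb := fun v => congrArg Prod.fst (hΦe v)
      rational_emb := fun q => ⟨Fin.append q 0, hιrat q⟩
      rational_proj := fun q => ⟨fun i => q (Fin.castAdd d i), rfl⟩ }
  exact ⟨Y, f, Φ, hΦ1, fun y => hM2 _, hΦe⟩

/-- The main amalgamation step. A contraction `i₀ : E → V` with an approximate left inverse `r` and
a `1`-complemented inclusion `E ⊆ F` are completed to an almost commutative square of `V` and `F`
in a rational space `Y`, which is the product `V × F` up to a renorming: `V` is embedded by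
`v ↦ (v, r v)` and `F` by `x ↦ (i₀ (S x), x)`, and the two coordinate projections are left inverses
of norm at most `1`. On `x ∈ E` the two embeddings differ by `(0, x - r (i₀ x))`. -/
theorem exists_almost_amalgam (V : RationalSpace) {F : Type*} [NormedAddCommGroup F]
    [NormedSpace ℝ F] [FiniteDimensional ℝ F] {E : Submodule ℝ F} (S : F →L[ℝ] E) (hS : ‖S‖ ≤ 1)
    (hSE : ∀ x : E, S x = x) (i₀ : E →L[ℝ] V) (hi₀ : ‖i₀‖ ≤ 1) (r : V →L[ℝ] E) (hr : ‖r‖ ≤ 1)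
    {δ : ℝ} (hδ : 0 < δ) (hδ1 : δ ≤ 1) (hri : ∀ x, ‖r (i₀ x) - x‖ ≤ δ * ‖x‖) :
    ∃ (Y : RationalSpace) (f : V ⟶ Y) (k : F →L[ℝ] Y) (q : Y →L[ℝ] F),
      IsEpsIsometry δ k ∧ (∀ y, ‖q y‖ ≤ ‖y‖) ∧ (∀ x, q (k x) = (1 + δ)⁻¹ • x) ∧
      ∀ x : E, ‖k x - f.emb (i₀ x)‖ ≤ 4 * δ * ‖x‖ := by
  obtain ⟨Y, f, Φ, hΦ1, hΦ2, hΦf⟩ := V.exists_rational_amalgam (E.subtypeL.comp r)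
    (ContinuousLinearMap.opNorm_le_bound _ zero_le_one fun v => r.le_of_opNorm_le hr v) hδ
  have hc : 0 < 1 + δ := by linarith
  have hc1 := one_sub_inv_one_add_le hδ.le
  have hc0 : 0 ≤ 1 - (1 + δ)⁻¹ := sub_nonneg.2 (inv_le_one_of_one_le₀ (by linarith))
  let κ : F →ₗ[ℝ] V × F := (i₀.toLinearMap ∘ₗ S.toLinearMap).prod LinearMap.id
  have hκ : ∀ x, κ x = (i₀ (S x), x) := fun x => rfl
  have hκn : ∀ x, ‖κ x‖ = ‖x‖ := fun x => by
    have h1 : ‖i₀ (S x)‖ ≤ ‖S x‖ := (i₀.le_of_opNorm_le hi₀ _).trans_eq (one_mul _)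
    have h2 : ‖S x‖ ≤ ‖x‖ := (S.le_of_opNorm_le hS x).trans_eq (one_mul _)
    rw [hκ, Prod.norm_def, max_eq_right (h1.trans h2)]
  -- The norm of `Y` exceeds that of `V × F` by a factor of up to `1 + δ`, so that `κ` has to be
  -- scaled down by this factor to become a contraction into `Y`.
  let k : F →L[ℝ] Y := LinearMap.toContinuousLinearMap ((1 + δ)⁻¹ • (Φ.symm.toLinearMap ∘ₗ κ))
  have hΦk : ∀ x, Φ (k x) = (1 + δ)⁻¹ • κ x := fun x => by
    change Φ ((1 + δ)⁻¹ • Φ.symm (κ x)) = _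
    rw [map_smul, Φ.apply_symm_apply]
  have hnk : ∀ x, ‖Φ (k x)‖ = (1 + δ)⁻¹ * ‖x‖ := fun x => by
    rw [hΦk, norm_smul, hκn, Real.norm_of_nonneg (by positivity)]
  let q : Y →L[ℝ] F := LinearMap.toContinuousLinearMap (LinearMap.snd ℝ V F ∘ₗ Φ.toLinearMap)
  refine ⟨Y, f, k, q, fun x => ⟨?_, ?_⟩, fun y => (norm_snd_le (Φ y)).trans (hΦ1 y),
    fun x => congrArg Prod.snd (hΦk x), fun x => ?_⟩
  · refine le_trans ?_ (hΦ1 _)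
    rw [hnk]
    exact mul_le_mul_of_nonneg_right (by linarith) (norm_nonneg x)
  · refine (hΦ2 _).trans_eq ?_
    rw [hnk, mul_inv_cancel_left₀ hc.ne']
  · have h2 : Φ (k x - f.emb (i₀ x)) =
        -((1 - (1 + δ)⁻¹) • κ x) - (0, ((r (i₀ x) - x : E) : F)) := by
      rw [map_sub, hΦk, hΦf, hκ, hSE]
      ext
      · simp; module
      · simp; module
    have h3 : ‖Φ (k x - f.emb (i₀ x))‖ ≤ 2 * δ * ‖x‖ := by
      rw [h2]
      refine (norm_sub_le _ _).trans ?_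
      rw [norm_neg, norm_smul, hκn, Real.norm_of_nonneg hc0, Prod.norm_mk, norm_zero,
        max_eq_right (norm_nonneg _)]
      have h4 : (1 - (1 + δ)⁻¹) * ‖(x : F)‖ ≤ δ * ‖x‖ :=
        mul_le_mul_of_nonneg_right hc1 (norm_nonneg _)
      have h5 : ‖((r (i₀ x) - x : E) : F)‖ ≤ δ * ‖x‖ := hri x
      linarith
    calc ‖k x - f.emb (i₀ x)‖ ≤ (1 + δ) * (2 * δ * ‖x‖) :=
          (hΦ2 _).trans (mul_le_mul_of_nonneg_left h3 hc.le)
      _ ≤ 2 * (2 * δ * ‖x‖) := mul_le_mul_of_nonneg_right (by linarith) (by positivity)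
      _ = 4 * δ * ‖x‖ := by ring

end RationalSpace

/-! ### The limit of a sequence of rational arrows -/

namespace RationalSeq

variable (U : RationalSeq)

/-- The bonding projection `U j → U i` for `i ≤ j`. -/
def bondProj (i j : ℕ) (h : i ≤ j) : U.obj j →L[ℝ] U.obj i := (U.map (homOfLE h)).proj

theorem norm_bondProj_apply_le (i j : ℕ) (h : i ≤ j) (x : U.obj j) : ‖U.bondProj i j h x‖ ≤ ‖x‖ :=
  ((U.bondProj i j h).le_of_opNorm_le (U.map (homOfLE h)).norm_proj_le x).trans_eq (one_mul _)

theorem bondProj_bondEmb (i j : ℕ) (h : i ≤ j) (x : U.obj i) :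
    U.bondProj i j h (U.bondEmb i j h x) = x :=
  (U.map (homOfLE h)).proj_emb x

theorem bondEmb_bondEmb {i j k : ℕ} (hij : i ≤ j) (hjk : j ≤ k) (x : U.obj i) :
    U.bondEmb j k hjk (U.bondEmb i j hij x) = U.bondEmb i k (hij.trans hjk) x :=
  DirectedSystem.map_map (f := fun i j h => U.bondEmb i j h) hij hjk x

theorem bondProj_bondProj {i j k : ℕ} (hij : i ≤ j) (hjk : j ≤ k) (x : U.obj k) :
    U.bondProj i j hij (U.bondProj j k hjk x) = U.bondProj i k (hij.trans hjk) x := by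
  have h : U.map (homOfLE (hij.trans hjk)) = U.map (homOfLE hij) ≫ U.map (homOfLE hjk) :=
    U.map_comp (homOfLE hij) (homOfLE hjk)
  change (U.map (homOfLE hij)).proj ((U.map (homOfLE hjk)).proj x) =
    (U.map (homOfLE (hij.trans hjk))).proj x
  rw [h]; rfl

/-- Passing from `U k` to `U n` through a common later space `U m` does not depend on `m`. -/
theorem bondProj_bondEmb_eq_of_le {n k m m' : ℕ} (hn : n ≤ m) (hk : k ≤ m) (hm : m ≤ m')
    (x : U.obj k) : U.bondProj n m' (hn.trans hm) (U.bondEmb k m' (hk.trans hm) x) =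
      U.bondProj n m hn (U.bondEmb k m hk x) := by
  rw [← U.bondEmb_bondEmb hk hm, ← U.bondProj_bondProj hn hm, bondProj_bondEmb]

/-- The inclusion of `U n` into the union of the chain. -/
noncomputable def unionEmb (n : ℕ) : U.obj n →ₗᵢ[ℝ] U.Union where
  toFun x := (⟦⟨n, x⟩⟧ : DirectLimit (fun n => (U.obj n : Type)) U.bondEmb)
  map_add' x y := (DirectLimit.add_def (f := U.bondEmb) n x y).symm
  map_smul' c x := (DirectLimit.smul_def (f := U.bondEmb) n x c).symm
  norm_map' _ := rfl

theorem exists_unionEmb_eq (x : U.Union) : ∃ n y, U.unionEmb n y = x := by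
  obtain ⟨n, y, rfl⟩ := DirectLimit.exists_eq_mk U.bondEmb x
  exact ⟨n, y, rfl⟩

theorem unionEmb_bondEmb {i j : ℕ} (h : i ≤ j) (x : U.obj i) :
    U.unionEmb j (U.bondEmb i j h x) = U.unionEmb i x :=
  (DirectLimit.eq_of_le (F := fun n => (U.obj n : Type)) (f := U.bondEmb) ⟨i, x⟩ j h).symm

/-- The function underlying the projection of the union of the chain onto `U n`: a point of `U k` is
moved to `U (max n k)` and from there projected to `U n`. -/
noncomputable def unionProjFun (n : ℕ) : U.Union → U.obj n :=
  DirectLimit.lift U.bondEmb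
    (fun k x => U.bondProj n (max n k) (le_max_left _ _)
      (U.bondEmb k (max n k) (le_max_right _ _) x))
    fun i j h x => by
      rw [U.bondEmb_bondEmb h,
        U.bondProj_bondEmb_eq_of_le (le_max_left n i) (le_max_right n i) (max_le_max le_rfl h)]

theorem unionProjFun_unionEmb {n m : ℕ} (h : n ≤ m) (x : U.obj m) :
    U.unionProjFun n (U.unionEmb m x) = U.bondProj n m h x := by
  have := U.bondProj_bondEmb_eq_of_le h le_rfl (le_max_right n m) x
  refine this.trans ?_
  congr 1
  exact DirectedSystem.map_self (f := fun i j h => U.bondEmb i j h) x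

/-- The projection of the union of the chain onto `U n`. -/
noncomputable def unionProj (n : ℕ) : U.Union →ₗ[ℝ] U.obj n where
  toFun := U.unionProjFun n
  map_add' x y := by
    obtain ⟨k, x, rfl⟩ := U.exists_unionEmb_eq x
    obtain ⟨l, y, rfl⟩ := U.exists_unionEmb_eq y
    have hk : k ≤ max n (max k l) := by simp
    have hl : l ≤ max n (max k l) := by simp
    rw [← U.unionEmb_bondEmb hk, ← U.unionEmb_bondEmb hl, ← LinearIsometry.map_add]
    simp_rw [U.unionProjFun_unionEmb (le_max_left n _), map_add]
  map_smul' c x := by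
    obtain ⟨k, x, rfl⟩ := U.exists_unionEmb_eq x
    rw [← U.unionEmb_bondEmb (le_max_right n k), ← LinearIsometry.map_smul]
    simp_rw [U.unionProjFun_unionEmb (le_max_left n k), map_smul, RingHom.id_apply]

theorem unionProj_unionEmb {n m : ℕ} (h : n ≤ m) (x : U.obj m) :
    U.unionProj n (U.unionEmb m x) = U.bondProj n m h x :=
  U.unionProjFun_unionEmb h x

theorem norm_unionProj_le (n : ℕ) (x : U.Union) : ‖U.unionProj n x‖ ≤ ‖x‖ := by
  obtain ⟨k, x, rfl⟩ := U.exists_unionEmb_eq x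
  rw [← U.unionEmb_bondEmb (le_max_right n k), U.unionProj_unionEmb (le_max_left n k),
    LinearIsometry.norm_map]
  exact U.norm_bondProj_apply_le _ _ _ _

instance (n : ℕ) : CompleteSpace (U.obj n) := FiniteDimensional.complete ℝ _

/-- The embedding-projection pair formed by the inclusion `U n → 𝐏` and the projection `𝐏 → U n`. -/
noncomputable def limitPair (n : ℕ) : EPPair (U.obj n) U.Limit where
  emb := (UniformSpace.Completion.toComplₗᵢ : U.Union →ₗᵢ[ℝ] U.Limit).comp (U.unionEmb n)
  proj := (U.unionProj n).extendOfNorm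
    (UniformSpace.Completion.toComplₗᵢ : U.Union →ₗᵢ[ℝ] U.Limit).toLinearMap
  norm_proj_le := ContinuousLinearMap.opNorm_le_bound _ zero_le_one
    (LinearMap.norm_extendOfNorm_apply_le UniformSpace.Completion.denseRange_coe 1 fun x => by
      simpa using U.norm_unionProj_le n x)
  proj_emb x := by
    refine (LinearMap.extendOfNorm_eq UniformSpace.Completion.denseRange_coe
      ⟨1, fun x => by simpa using U.norm_unionProj_le n x⟩ _).trans ?_
    refine (U.unionProj_unionEmb le_rfl x).trans ?_
    nth_rw 2 [← U.bondProj_bondEmb n n le_rfl x]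
    congr 1
    exact (DirectedSystem.map_self (f := fun i j h => U.bondEmb i j h) x).symm

theorem limitPair_emb_bondEmb {n m : ℕ} (h : n ≤ m) (x : U.obj n) :
    (U.limitPair m).emb (U.bondEmb n m h x) = (U.limitPair n).emb x :=
  congrArg (UniformSpace.Completion.toComplₗᵢ : U.Union →ₗᵢ[ℝ] U.Limit) (U.unionEmb_bondEmb h x)

theorem norm_limitPair_proj_le (n : ℕ) (x : U.Limit) : ‖(U.limitPair n).proj x‖ ≤ ‖x‖ :=
  ((U.limitPair n).proj.le_of_opNorm_le (U.limitPair n).norm_proj_le x).trans_eq (one_mul _)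

open Filter Topology in
theorem tendsto_limitPair_emb_proj (x : U.Limit) :
    Tendsto (fun n => (U.limitPair n).emb ((U.limitPair n).proj x)) atTop (𝓝 x) := by
  refine Metric.tendsto_atTop.2 fun ε hε => ?_
  obtain ⟨y, hy⟩ := UniformSpace.Completion.denseRange_coe.exists_dist_lt x (half_pos hε)
  obtain ⟨k, u, rfl⟩ := U.exists_unionEmb_eq y
  refine ⟨k, fun n hn => ?_⟩
  set z : U.Limit := (U.limitPair n).emb (U.bondEmb k n hn u) with hz
  have hzx : ‖x - z‖ < ε / 2 := by
    rw [hz, limitPair_emb_bondEmb, ← dist_eq_norm]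
    exact hy
  have h1 : (U.limitPair n).emb ((U.limitPair n).proj x) - x =
      (U.limitPair n).emb ((U.limitPair n).proj (x - z)) - (x - z) := by
    rw [map_sub, map_sub, hz, EPPair.proj_emb]; abel
  rw [dist_eq_norm, h1]
  have h2 := norm_sub_le ((U.limitPair n).emb ((U.limitPair n).proj (x - z))) (x - z)
  rw [LinearIsometry.norm_map] at h2
  linarith [U.norm_limitPair_proj_le n (x - z)]

open Filter in
/-- The projections `𝐏 → U n → 𝐏` converge to the identity uniformly on the unit ball of a
finite-dimensional space, since they do so on a basis. -/
theorem exists_norm_limitPair_emb_proj_sub_le {E : Type*} [NormedAddCommGroup E] [NormedSpace ℝ E]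
    [FiniteDimensional ℝ E] (i : E →L[ℝ] U.Limit) {δ : ℝ} (hδ : 0 < δ) :
    ∃ n, ∀ x, ‖(U.limitPair n).emb ((U.limitPair n).proj (i x)) - i x‖ ≤ δ * ‖x‖ := by
  let b := Module.finBasis ℝ E
  obtain ⟨C, hC, hCb⟩ := b.exists_opNorm_le (F := U.Limit)
  have hev : ∀ᶠ n in atTop, ∀ l,
      ‖(U.limitPair n).emb ((U.limitPair n).proj (i (b l))) - i (b l)‖ ≤ δ / C :=
    eventually_all.2 fun l => by
      filter_upwards [Metric.tendsto_nhds.1 (U.tendsto_limitPair_emb_proj (i (b l))) (δ / C)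
        (by positivity)] with n hn
      rw [← dist_eq_norm]
      exact hn.le
  obtain ⟨n, hn⟩ := hev.exists
  let u : E →L[ℝ] U.Limit :=
    ((U.limitPair n).emb.toContinuousLinearMap.comp (U.limitPair n).proj).comp i - i
  have hu : ‖u‖ ≤ δ := (hCb (u := u) (by positivity) hn).trans_eq (by field_simp)
  exact ⟨n, fun x => u.le_of_opNorm_le hu x⟩

end RationalSeq

/-! ### The almost-extension property -/

theorem mainTheorem2 (U : RationalSeq) (hU : U.IsFraisse) : ConditionE.{u} U.Limit := by
  intro F _ _ _ E hE i hi ε hε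
  obtain ⟨S, hS, hSE⟩ := hE
  obtain ⟨R, hR, hRi⟩ := hi
  obtain ⟨δ, hδ, hδ1, hδε⟩ : ∃ δ : ℝ, 0 < δ ∧ δ ≤ 1 ∧ 5 * δ < ε :=
    ⟨min 1 (ε / 6), by positivity, min_le_left _ _, by linarith [min_le_right 1 (ε / 6)]⟩
  -- The projection onto `i[E]`, read as a left inverse `r` of `i`.
  let r : U.Limit →L[ℝ] E :=
    (i.equivRange.symm.toLinearIsometry.toContinuousLinearMap : _ →L[ℝ] E).comp R
  have hr : ∀ x, ‖r x‖ ≤ ‖x‖ := fun x => by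
    change ‖i.equivRange.symm (R x)‖ ≤ ‖x‖
    rw [LinearIsometryEquiv.norm_map]
    exact (R.le_of_opNorm_le hR x).trans_eq (one_mul _)
  have hri : ∀ x, r (i x) = x := fun x => by
    change i.equivRange.symm (R (i x)) = x
    rw [LinearIsometryEquiv.symm_apply_eq]
    exact hRi ⟨i x, x, rfl⟩
  obtain ⟨n, hn⟩ := U.exists_norm_limitPair_emb_proj_sub_le i.toContinuousLinearMap hδ
  set η := U.limitPair n with hη
  obtain ⟨Y, f, k, q, hk, hq, hqk, hkf⟩ := (U.obj n).exists_almost_amalgam S hS hSE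
    (η.proj.comp i.toContinuousLinearMap)
    (ContinuousLinearMap.opNorm_le_bound _ zero_le_one fun x => by
      rw [one_mul]
      exact (U.norm_limitPair_proj_le n _).trans_eq (i.norm_map x))
    (r.comp η.emb.toContinuousLinearMap)
    (ContinuousLinearMap.opNorm_le_bound _ zero_le_one fun v => by
      rw [one_mul]
      exact (hr _).trans_eq (η.emb.norm_map v))
    hδ hδ1 fun x => by
      have h : r (η.emb (η.proj (i x))) - x = r (η.emb (η.proj (i x)) - i x) := by
        rw [map_sub, hri]
      exact (congrArg norm h).trans_le ((hr _).trans (hn x))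
  obtain ⟨m, hnm, g', hg'⟩ := hU n Y f
  have hg'f : ∀ v, g'.emb (f.emb v) = U.bondEmb n m hnm.le v := fun v => by
    change (f ≫ g').emb v = _
    rw [hg']; rfl
  let θ : EPPair Y U.Limit := g'.toEPPair.trans (U.limitPair m)
  have hθf : ∀ v, θ.emb (f.emb v) = η.emb v := fun v => by
    rw [hη, ← U.limitPair_emb_bondEmb hnm.le, ← hg'f]
    rfl
  let g : F →L[ℝ] U.Limit := θ.emb.toContinuousLinearMap.comp k
  have hgn : ∀ x, ‖g x‖ = ‖k x‖ := fun x => θ.emb.norm_map _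
  refine ⟨g, fun x => ?_, ?_, ?_⟩
  · rw [hgn]
    exact ⟨le_trans (mul_le_mul_of_nonneg_right (by linarith) (norm_nonneg x)) (hk x).1, (hk x).2⟩
  · refine lt_of_le_of_lt (ContinuousLinearMap.opNorm_le_bound _ (by positivity) fun x => ?_) hδε
    change ‖g x - i x‖ ≤ 5 * δ * ‖x‖
    have h1 : ‖g x - η.emb (η.proj (i x))‖ ≤ 4 * δ * ‖x‖ := by
      rw [← hθf]
      change ‖θ.emb (k x) - _‖ ≤ _
      rw [← map_sub, LinearIsometry.norm_map]
      exact hkf x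
    have h2 : ‖η.emb (η.proj (i x)) - i x‖ ≤ δ * ‖x‖ := hn x
    linarith [norm_sub_le_norm_sub_add_norm_sub (g x) (η.emb (η.proj (i x))) (i x)]
  · -- On `g[F]` the operator `g ∘ q ∘ θ.proj` is multiplication by `(1 + δ)⁻¹`.
    let T : U.Limit →L[ℝ] LinearMap.range g.toLinearMap :=
      (g.codRestrict _ fun x => LinearMap.mem_range_self _ x).comp (q.comp θ.proj)
    refine ⟨T, ContinuousLinearMap.opNorm_le_bound _ zero_le_one fun z => ?_, ?_⟩
    · change ‖g (q (θ.proj z))‖ ≤ 1 * ‖z‖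
      rw [hgn]
      exact (hk _).2.trans ((hq _).trans (θ.proj.le_of_opNorm_le θ.norm_proj_le z))
    · rintro ⟨_, x, rfl⟩
      have h : q (θ.proj (g x)) = (1 + δ)⁻¹ • x := (congrArg q (θ.proj_emb (k x))).trans (hqk x)
      change ‖g (q (θ.proj (g x))) - g x‖ ≤ ε * ‖g x‖
      rw [h, map_smul, ← neg_sub, norm_neg]
      have h1 : g x - (1 + δ)⁻¹ • g x = (1 - (1 + δ)⁻¹) • g x := by module
      rw [h1, norm_smul, Real.norm_of_nonneg (sub_nonneg.2 (inv_le_one_of_one_le₀ (by linarith)))]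
      exact mul_le_mul_of_nonneg_right (by linarith [one_sub_inv_one_add_le hδ.le])
        (norm_nonneg _)
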